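/- Let $b,\delta,N>0$, let $g:[0,\delta]\to\mathbb{R}_+$ be a probability density, and let $m_i=\int_0^\delta v^i g(v)\,dv$ for $i\in\{1,2\}$. Let $n_0:\mathbb{R}_+\to\mathbb{R}_+$ be a probability density with $n_0\in H^3(\mathbb{R}_+)$, $n_0(0)=0$ and $n_0''(0)=0$. Assume that there are $C_\lambda,D_\lambda,\lambda>0$ and $\lambda'\in\left[0,\frac{2Nm_1}{m_2}-2\lambda\right)$ such that, for $x\ge 0$, $$|n_0'''(x)|\le C_\lambda e^{-\lambda x}\quad\text{(almost everywhere)},\qquad |n_0''(x)|\le D_\lambda e^{-\lambda x}\left(1-e^{-\lambda' x}\right).$$ Let $u^{(N)}\in C^0(\mathbb{R}_+,H^2(\mathbb{R}_+))\cap C^1(\mathbb{R}_+,L^2(\mathbb{R}_+))$, together with $u_\partial^{(N)}:\mathbb{R}_+\to\mathbb{R}$, be the solution of $$\begin{cases}\partial_t u^{(N)}(t,x)=bm_1\,\partial_x u^{(N)}(t,x)+\frac{bm_2}{2N}\,\partial_x^2u^{(N)}(t,x), & t,x\ge0,\\ \partial_t u^{(N)}(t,0)=bm_1\,\partial_xu^{(N)}(t,0),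 & t\ge0,\\ u_\partial^{(N)}(t)=bm_1u^{(N)}(t,0)+\frac{bm_2}{2N}\,\partial_xu^{(N)}(t,0), & t\ge0,\\ u^{(N)}(0,x)=n_0(x), & x\ge0.\end{cases}$$ For $f:\mathbb{R}_+\to\mathbb{R}$ write $\mathcal{L}(f)(p)=\int_0^\infty e^{-px}f(x)\,dx$ and $\mathcal{R}(f)=\inf\{r\in\mathbb{R} : \int_0^\infty e^{-rx}|f(x)|\,dx<\infty\}\in[-\infty,+\infty]$. Let $q_N(p)=bm_1p+\frac{bm_2}{2N}p^2$ and $$\mathcal{P}_N=\left\{p\in\mathbb{C} : \operatorname{Re}p>\mathcal{R}(n_0),\ \operatorname{Re}q_N(p)>\max\left(\mathcal{R}(u_\partial^{(N)}),\,-(bm_1)^2\tfrac{2N}{bm_2}\right)\right\}.$$ Then, for every $p\in\mathcal{P}_N$ that lies in the same connected component of $\mathcal{P}_N$ as some positive real number (so for every $p\in\mathcal{P}_N$ whenever $\mathcal{P}_N$ is connected), $$\mathcal{L}(n_0)(p)=\left(1+p\,\frac{bm_1}{(bm_1)^2\frac{2N}{bm_2}+q_N(p)}\right)\mathcal{L}\left(u_\partial^{(N)}\right)\left(q_N(p)\right).$$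 -/

import Mathlib

open MeasureTheory Set Filter Topology

noncomputable section

namespace Telomere

/-- Lebesgue measure on the half-line `(0, ∞)`. -/
abbrev halfLine : Measure ℝ := volume.restrict (Ioi (0 : ℝ))

/-- The Hilbert space `L²(ℝ₊)`. -/
abbrev L2 : Type := Lp ℝ 2 halfLine

/-- `f ∈ H¹(ℝ₊)` with weak derivative `f'`, where `f` is the continuous representative on `[0, ∞)`:
both functions are square integrable and `f` is the primitive of `f'`.
In particular `f 0` is the trace of `f` at `0`, and `f'` is determined almost everywhere. -/
structure HasSobolevDeriv (f f' : ℝ → ℝ) : Prop where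
  memLp : MemLp f 2 halfLine
  memLp_deriv : MemLp f' 2 halfLine
  eq_integral : ∀ x : ℝ, 0 ≤ x → f x = f 0 + ∫ y in (0 : ℝ)..x, f' y

/-- `t ↦ f t` belongs to `C⁰(ℝ₊, L²(ℝ₊))`. -/
def ContinuousInL2 (f : ℝ → ℝ → ℝ) : Prop :=
  ∃ F : ℝ → L2, ContinuousOn F (Ici 0) ∧ ∀ t : ℝ, 0 ≤ t → f t =ᵐ[halfLine] F t

/-- `t ↦ f t` belongs to `C¹(ℝ₊, L²(ℝ₊))`, with derivative `t ↦ f' t`. -/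
def HasTimeDerivInL2 (f f' : ℝ → ℝ → ℝ) : Prop :=
  ∃ F F' : ℝ → L2, ContinuousOn F' (Ici 0) ∧ ∀ t : ℝ, 0 ≤ t →
    f t =ᵐ[halfLine] F t ∧ f' t =ᵐ[halfLine] F' t ∧ HasDerivWithinAt F (F' t) (Ici 0) t

/-- `g` restricted to `[0, δ]` is a probability density function. -/
structure IsDensityOnIcc (g : ℝ → ℝ) (δ : ℝ) : Prop where
  nonneg : ∀ v ∈ Icc 0 δ, 0 ≤ g v
  integrable : IntegrableOn g (Icc 0 δ)
  integral_eq_one : ∫ v in (0 : ℝ)..δ, g v = 1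

/-- The moment `m_i = ∫₀^δ v^i g(v) dv`. -/
def shorteningMoment (g : ℝ → ℝ) (δ : ℝ) (i : ℕ) : ℝ := ∫ v in (0 : ℝ)..δ, v ^ i * g v

/-- `n₀` restricted to `[0, ∞)` is a probability density function. -/
structure IsDensityOnIci (n₀ : ℝ → ℝ) : Prop where
  nonneg : ∀ x : ℝ, 0 ≤ x → 0 ≤ n₀ x
  integrable : IntegrableOn n₀ (Ioi 0)
  integral_eq_one : ∫ x in Ioi (0 : ℝ), n₀ x = 1

/-- `(u, uB)` solves, in `C⁰(ℝ₊, H²(ℝ₊)) ∩ C¹(ℝ₊, L²(ℝ₊))`, the advection-diffusion system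
* `∂ₜ u(t,x) = b m₁ ∂ₓ u(t,x) + (b m₂ / 2N) ∂ₓ² u(t,x)`,
* `∂ₜ u(t,0) = b m₁ ∂ₓ u(t,0)`,
* `uB(t) = b m₁ u(t,0) + (b m₂ / 2N) ∂ₓ u(t,0)`,
* `u(0,x) = n₀(x)`,
for `t, x ≥ 0`. The functions `ux`, `uxx`, `ut` are `∂ₓ u`, `∂ₓ² u`, `∂ₜ u`; since `u t` and `ux t` are
continuous representatives, `u t 0` and `ux t 0` are boundary traces. -/
def IsApproxSolution (b m₁ m₂ N : ℝ) (n₀ : ℝ → ℝ) (u : ℝ → ℝ → ℝ) (uB : ℝ → ℝ) : Prop :=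
  ∃ ux uxx ut : ℝ → ℝ → ℝ,
    (∀ t : ℝ, 0 ≤ t → HasSobolevDeriv (u t) (ux t) ∧ HasSobolevDeriv (ux t) (uxx t)) ∧
    ContinuousInL2 u ∧ ContinuousInL2 ux ∧ ContinuousInL2 uxx ∧
    HasTimeDerivInL2 u ut ∧
    (∀ t : ℝ, 0 ≤ t → ∀ᵐ x ∂halfLine,
      ut t x = b * m₁ * ux t x + b * m₂ / (2 * N) * uxx t x) ∧
    (∀ t : ℝ, 0 ≤ t → HasDerivWithinAt (fun s => u s 0) (b * m₁ * ux t 0) (Ici 0) t) ∧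
    (∀ t : ℝ, 0 ≤ t → uB t = b * m₁ * u t 0 + b * m₂ / (2 * N) * ux t 0) ∧
    (∀ x : ℝ, 0 ≤ x → u 0 x = n₀ x)

/-- The Laplace transform `∫₀^∞ e^{-px} f(x) dx`. -/
def laplace (f : ℝ → ℝ) (p : ℂ) : ℂ :=
  ∫ x in Ioi (0 : ℝ), Complex.exp (-p * (x : ℂ)) * (f x : ℂ)

/-- The abscissa of (absolute) convergence of the Laplace transform of `f`, an extended real. -/
def abscissa (f : ℝ → ℝ) : EReal :=
  sInf ((fun r : ℝ => (r : EReal)) ''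
    {r : ℝ | IntegrableOn (fun x => Real.exp (-r * x) * |f x|) (Ioi 0)})

/-- The polynomial `q_N(p) = b m₁ p + (b m₂ / 2N) p²`. -/
def qN (b m₁ m₂ N : ℝ) (p : ℂ) : ℂ := (b : ℂ) * m₁ * p + (b : ℂ) * m₂ / (2 * N) * p ^ 2

/-- The region `𝒫_N`. -/
def regionP (b m₁ m₂ N : ℝ) (n₀ uB : ℝ → ℝ) : Set ℂ :=
  {p : ℂ | abscissa n₀ < (p.re : EReal) ∧
    max (abscissa uB) ((-((b * m₁) ^ 2 * (2 * N / (b * m₂))) : ℝ) : EReal)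
      < ((qN b m₁ m₂ N p).re : EReal)}

/-- The points of `𝒫_N` that lie in the same connected component of `𝒫_N` as some positive real
number. -/
def regionPMain (b m₁ m₂ N : ℝ) (n₀ uB : ℝ → ℝ) : Set ℂ :=
  {p : ℂ | ∃ x : ℝ, 0 < x ∧ p ∈ connectedComponentIn (regionP b m₁ m₂ N n₀ uB) (x : ℂ)}

end Telomere

end

/-! ### Sobolev functions and Laplace transforms on the half-line. -/

namespace Telomere

/-! Put a = b m₁, c = b m₂ / 2N, q = q_N(p). For real p > 0, pairing the equation with e^{-px} gives
d/dt L(u(t))(p) = q L(u(t))(p) - uB(t) - c p u(t,0). The energy estimate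
`SolutionCurve.exists_bound` keeps L(u(t))(p) bounded, so multiplying by e^{-qt} and integrating in
time leaves L(n₀)(p) = A + c p B, where A and B are the transforms at q of uB and of the trace
u(·,0). Eliminating ∂ₓu(t,0) between the two boundary conditions gives a linear ODE for the trace;
since n₀(0) = 0, it yields (q + a²/c) B = (a/c) A. Substituting B proves the formula
(`SolutionCurve.integral_exp_initial`). Both sides are holomorphic on 𝒫_N, and the identity theorem
carries the equality from the positive reals to the components that meet them. -/

theorem HasSobolevDeriv.intervalIntegrable {f f' : ℝ → ℝ} (hf : HasSobolevDeriv f f')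
    {R : ℝ} (hR : 0 ≤ R) : IntervalIntegrable f' volume 0 R := by
  rw [intervalIntegrable_iff_integrableOn_Ioc_of_le hR]
  have h : MemLp f' 2 (volume.restrict (Ioc 0 R)) :=
    hf.memLp_deriv.mono_measure (Measure.restrict_mono Ioc_subset_Ioi_self le_rfl)
  exact h.integrable (by norm_num)

/-- Integration by parts on `[0, R]` for Sobolev functions. -/
theorem HasSobolevDeriv.intervalIntegral_mul_add {f f' g g' : ℝ → ℝ}
    (hf : HasSobolevDeriv f f') (hg : HasSobolevDeriv g g') {R : ℝ} (hR : 0 ≤ R) :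
    ∫ x in (0 : ℝ)..R, (f' x * g x + f x * g' x) = f R * g R - f 0 * g 0 := by
  -- `h` is prescribed only on [0, ∞), so its primitive formula, defined on all of ℝ, is the
  -- function to differentiate.
  have key : ∀ {h h' : ℝ → ℝ}, HasSobolevDeriv h h' →
      AbsolutelyContinuousOnInterval (fun x => h 0 + ∫ y in (0 : ℝ)..x, h' y) 0 R ∧
      ∀ᵐ x, x ∈ uIcc 0 R → deriv (fun x => h 0 + ∫ y in (0 : ℝ)..x, h' y) x = h' x := by
    intro h h' hh
    have hi := hh.intervalIntegrable hR
    refine ⟨?_, ?_⟩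
    · have hc : AbsolutelyContinuousOnInterval (fun _ : ℝ => h 0) 0 R :=
        contDiffOn_const.absolutelyContinuousOnInterval
      exact hc.fun_add (hi.absolutelyContinuousOnInterval_intervalIntegral (c := 0) (by simp))
    · filter_upwards [hi.ae_hasDerivAt_integral] with x hx hxR
      exact ((hx hxR 0 (by simp)).const_add (h 0)).deriv
  have h := (key hf).1.integral_deriv_mul_eq_sub (key hg).1
  rw [← hf.eq_integral R hR, ← hg.eq_integral R hR] at h
  simp only [intervalIntegral.integral_same, add_zero] at h
  rw [← h]
  apply intervalIntegral.integral_congr_ae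
  filter_upwards [(key hf).2, (key hg).2] with x hx hx' hxR
  have hxR' := uIoc_subset_uIcc hxR
  have hx0 : 0 ≤ x := by rw [uIoc_of_le hR] at hxR; exact hxR.1.le
  rw [hx hxR', hx' hxR', ← hf.eq_integral x hx0, ← hg.eq_integral x hx0]

/-- Integration by parts on the half-line for Sobolev functions. -/
theorem HasSobolevDeriv.integral_mul_add {f f' g g' : ℝ → ℝ}
    (hf : HasSobolevDeriv f f') (hg : HasSobolevDeriv g g') :
    (∫ x, f' x * g x ∂halfLine) + ∫ x, f x * g' x ∂halfLine = -(f 0 * g 0) := by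
  have i1 : Integrable (fun x => f' x * g x) halfLine := hf.memLp_deriv.integrable_mul hg.memLp
  have i2 : Integrable (fun x => f x * g' x) halfLine := hf.memLp.integrable_mul hg.memLp_deriv
  have i3 : Integrable (fun x => f x * g x) halfLine := hf.memLp.integrable_mul hg.memLp
  rw [← integral_add i1 i2]
  have hlim := intervalIntegral_tendsto_integral_Ioi 0 (i1.add i2) tendsto_id
  have hlim2 : Tendsto (fun R => f R * g R) atTop
      (𝓝 ((∫ x, (f' x * g x + f x * g' x) ∂halfLine) + f 0 * g 0)) := by
    refine (hlim.add_const (f 0 * g 0)).congr' ?_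
    filter_upwards [eventually_ge_atTop 0] with R hR
    have := hf.intervalIntegral_mul_add hg hR
    simp only [Pi.add_apply, id]
    linarith
  -- An integrable function that converges at infinity can only tend to 0, so the boundary term at
  -- infinity vanishes.
  have := IntegrableAtFilter.eq_zero_of_tendsto (μ := volume)
    ⟨Ioi 0, Ioi_mem_atTop _, i3⟩ (fun s hs => by
      obtain ⟨b, hb⟩ := mem_atTop_sets.1 hs
      rw [← top_le_iff, ← Real.volume_Ici (a := b)]
      exact measure_mono hb) hlim2
  linarith

theorem memLp_exp_neg_mul {p : ℝ} (hp : 0 < p) :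
    MemLp (fun x : ℝ => Real.exp (-p * x)) 2 halfLine := by
  rw [memLp_two_iff_integrable_sq (by fun_prop)]
  refine (integrableOn_exp_mul_Ioi (a := -(2 * p)) (by linarith) 0).congr (ae_of_all _ fun x => ?_)
  simp only [← Real.exp_nat_mul]
  congr 1; push_cast; ring

theorem hasSobolevDeriv_exp_neg_mul {p : ℝ} (hp : 0 < p) :
    HasSobolevDeriv (fun x : ℝ => Real.exp (-p * x)) (fun x => -p * Real.exp (-p * x)) where
  memLp := memLp_exp_neg_mul hp
  memLp_deriv := (memLp_exp_neg_mul hp).const_mul (-p)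
  eq_integral x _ := by
    rw [intervalIntegral.integral_eq_sub_of_hasDerivAt (f := fun x => Real.exp (-p * x))]
    · ring
    · intro y _
      simpa [mul_comm] using ((hasDerivAt_id y).const_mul (-p)).exp
    · exact Continuous.intervalIntegrable (by fun_prop) _ _

/-- The pairing of two `L²` classes is the integral of the product of representatives. -/
theorem inner_eq_integral {f g : ℝ → ℝ} {F G : L2} (hf : f =ᵐ[halfLine] F)
    (hg : g =ᵐ[halfLine] G) : inner ℝ F G = ∫ x, f x * g x ∂halfLine := by
  rw [L2.inner_def]
  refine integral_congr_ae ?_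
  filter_upwards [hf, hg] with x hx hx'
  rw [hx, hx']
  simp [mul_comm]

/-- The integrand of the Laplace transform is integrable to the right of the abscissa. -/
theorem exists_integrable_of_abscissa_lt {f : ℝ → ℝ} {s : ℝ} (h : abscissa f < s) :
    ∃ r < s, IntegrableOn (fun x => Real.exp (-r * x) * |f x|) (Ioi 0) := by
  obtain ⟨_, ⟨r, hr, rfl⟩, hrs⟩ := sInf_lt_iff.1 h
  exact ⟨r, EReal.coe_lt_coe_iff.1 hrs, hr⟩

theorem integrable_laplace {f : ℝ → ℝ} (hf : AEStronglyMeasurable f halfLine) {s : ℂ} {r : ℝ}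
    (hrs : r ≤ s.re) (hr : IntegrableOn (fun x => Real.exp (-r * x) * |f x|) (Ioi 0)) :
    Integrable (fun x : ℝ => Complex.exp (-s * (x : ℂ)) * (f x : ℂ)) halfLine := by
  refine Integrable.mono' hr ?_ ?_
  · exact (Continuous.aestronglyMeasurable (by fun_prop)).mul
      (Complex.continuous_ofReal.comp_aestronglyMeasurable hf)
  · filter_upwards [ae_restrict_mem measurableSet_Ioi] with x hx
    have hx : 0 < x := hx
    rw [norm_mul, Complex.norm_exp, Complex.norm_real, Real.norm_eq_abs]
    gcongr
    simp
    nlinarith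

theorem laplace_ofReal (f : ℝ → ℝ) (p : ℝ) :
    laplace f p = ((∫ x in Ioi (0 : ℝ), Real.exp (-p * x) * f x : ℝ) : ℂ) := by
  rw [laplace, ← integral_complex_ofReal]
  simp

/-- Differentiation under the integral. Half of the gap between `s.re` and `r` is the radius of the
ball; the other half absorbs the new factor x through x e^{-εx} ≤ 1/ε. -/
theorem differentiableAt_laplace {f : ℝ → ℝ} (hf : AEStronglyMeasurable f halfLine) {s : ℂ}
    (hs : abscissa f < s.re) : DifferentiableAt ℂ (laplace f) s := by
  obtain ⟨r, hrs, hr⟩ := exists_integrable_of_abscissa_lt hs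
  set ε := (s.re - r) / 2 with hε
  have hε0 : 0 < ε := by linarith
  have hmeas : ∀ z : ℂ, AEStronglyMeasurable
      (fun x : ℝ => Complex.exp (-z * (x : ℂ)) * (f x : ℂ)) halfLine := fun z =>
    (Continuous.aestronglyMeasurable (by fun_prop)).mul
      (Complex.continuous_ofReal.comp_aestronglyMeasurable hf)
  refine (hasDerivAt_integral_of_dominated_loc_of_deriv_le (μ := halfLine)
    (F := fun (z : ℂ) (x : ℝ) => Complex.exp (-z * (x : ℂ)) * (f x : ℂ))
    (F' := fun (z : ℂ) (x : ℝ) => -(x : ℂ) * (Complex.exp (-z * (x : ℂ)) * (f x : ℂ)))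
    (bound := fun x => ε⁻¹ * (Real.exp (-r * x) * |f x|))
    (Metric.ball_mem_nhds s hε0) (Eventually.of_forall hmeas)
    (integrable_laplace hf hrs.le hr) ?_ ?_ (hr.const_mul _) ?_).2.differentiableAt
  · exact (Continuous.aestronglyMeasurable (by fun_prop)).mul (hmeas s)
  · filter_upwards [ae_restrict_mem measurableSet_Ioi] with x hx z hz
    have hx : 0 < x := hx
    have hz' : r + ε ≤ z.re := by
      have h1 : |(z - s).re| ≤ ‖z - s‖ := Complex.abs_re_le_norm _
      rw [mem_ball_iff_norm] at hz
      have h2 := neg_abs_le (z - s).re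
      rw [Complex.sub_re] at h1 h2
      linarith
    rw [norm_mul, norm_mul, Complex.norm_exp, Complex.norm_real, norm_neg, Complex.norm_real,
      Real.norm_eq_abs, Real.norm_eq_abs, abs_of_pos hx, ← mul_assoc, ← mul_assoc]
    refine mul_le_mul_of_nonneg_right ?_ (abs_nonneg _)
    have h3 : (-z * (x : ℂ)).re ≤ -r * x + -(ε * x) := by
      simp
      nlinarith
    calc x * Real.exp (-z * (x : ℂ)).re
        ≤ x * (Real.exp (-r * x) * Real.exp (-(ε * x))) := by
          rw [← Real.exp_add]; gcongr
      _ = ε⁻¹ * Real.exp (-r * x) * ((ε * x) * Real.exp (-(ε * x))) := by field_simp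
      _ ≤ ε⁻¹ * Real.exp (-r * x) * 1 := by
          gcongr
          rw [Real.exp_neg, mul_inv_le_iff₀ (Real.exp_pos _)]
          linarith [Real.add_one_le_exp (ε * x)]
      _ = _ := by ring
  · refine ae_of_all _ fun x z _ => ?_
    have h1 : HasDerivAt (fun z : ℂ => -z * (x : ℂ)) (-(x : ℂ)) z := by
      simpa using (hasDerivAt_id z).neg.mul_const (x : ℂ)
    exact (h1.cexp.mul_const (f x : ℂ)).congr_deriv (by ring)

end Telomere

/-! ### Energy estimate and the formula for real p > 0. -/

namespace Telomere

/-- The data of a solution of the advection-diffusion system with `a = b m₁`, `c = b m₂ / 2N`,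
together with its `L²`-valued curve `F` and the time derivative `F'` of this curve. -/
structure SolutionCurve (a c : ℝ) (u ux uxx : ℝ → ℝ → ℝ) (uB : ℝ → ℝ) (F F' : ℝ → L2) :
    Prop where
  sobolev : ∀ t : ℝ, 0 ≤ t → HasSobolevDeriv (u t) (ux t)
  sobolev' : ∀ t : ℝ, 0 ≤ t → HasSobolevDeriv (ux t) (uxx t)
  eq_curve : ∀ t : ℝ, 0 ≤ t → u t =ᵐ[halfLine] F t
  pde : ∀ t : ℝ, 0 ≤ t → (fun x => a * ux t x + c * uxx t x) =ᵐ[halfLine] F' t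
  deriv_curve : ∀ t : ℝ, 0 ≤ t → HasDerivWithinAt F (F' t) (Ici 0) t
  deriv_trace : ∀ t : ℝ, 0 ≤ t → HasDerivWithinAt (fun s => u s 0) (a * ux t 0) (Ici 0) t
  flux : ∀ t : ℝ, 0 ≤ t → uB t = a * u t 0 + c * ux t 0

theorem HasSobolevDeriv.linear_comb {f f' g g' : ℝ → ℝ} (hf : HasSobolevDeriv f f')
    (hg : HasSobolevDeriv g g') (a c : ℝ) :
    HasSobolevDeriv (fun x => a * f x + c * g x) (fun x => a * f' x + c * g' x) where
  memLp := (hf.memLp.const_mul a).add (hg.memLp.const_mul c)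
  memLp_deriv := (hf.memLp_deriv.const_mul a).add (hg.memLp_deriv.const_mul c)
  eq_integral x hx := by
    rw [intervalIntegral.integral_add ((hf.intervalIntegrable hx).const_mul a)
      ((hg.intervalIntegrable hx).const_mul c), intervalIntegral.integral_const_mul,
      intervalIntegral.integral_const_mul, hf.eq_integral x hx, hg.eq_integral x hx]
    ring

namespace SolutionCurve

variable {a c : ℝ} {u ux uxx : ℝ → ℝ → ℝ} {uB : ℝ → ℝ} {F F' : ℝ → L2}

/-- The weak form of the equation, tested against a Sobolev function. -/
theorem inner_deriv (h : SolutionCurve a c u ux uxx uB F F') {t : ℝ} (ht : 0 ≤ t)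
    {φ φ' : ℝ → ℝ} {Φ : L2} (hφ : HasSobolevDeriv φ φ') (hΦ : φ =ᵐ[halfLine] Φ) :
    inner ℝ Φ (F' t) = -(φ 0 * uB t) - a * (∫ x, φ' x * u t x ∂halfLine)
      - c * ∫ x, φ' x * ux t x ∂halfLine := by
  have h1 := hφ.integral_mul_add ((h.sobolev t ht).linear_comb (h.sobolev' t ht) a c)
  have h2 : ∫ x, φ' x * (a * u t x + c * ux t x) ∂halfLine
      = a * (∫ x, φ' x * u t x ∂halfLine) + c * ∫ x, φ' x * ux t x ∂halfLine := by
    rw [← integral_const_mul, ← integral_const_mul, ← integral_add]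
    · congr 1; ext x; ring
    · exact (hφ.memLp_deriv.integrable_mul (h.sobolev t ht).memLp).const_mul a
    · exact (hφ.memLp_deriv.integrable_mul (h.sobolev' t ht).memLp).const_mul c
  rw [inner_eq_integral hΦ (h.pde t ht), h.flux t ht]
  linarith

/-- The energy `‖u‖² + (c / a) u(·, 0)²` is non-increasing, hence the solution is bounded. -/
theorem exists_bound (h : SolutionCurve a c u ux uxx uB F F') (ha : 0 < a) (hc : 0 < c) :
    ∃ K, ∀ t : ℝ, 0 ≤ t → ‖F t‖ ≤ K ∧ |u t 0| ≤ K := by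
  -- The weight c / a makes the derivative of the trace term cancel the boundary product 2c u(t,0)
  -- ∂ₓu(t,0).
  set E : ℝ → ℝ := fun t => inner ℝ (F t) (F t) + c / a * (u t 0) ^ 2 with hE
  have hder : ∀ t : ℝ, 0 ≤ t → HasDerivWithinAt E
      (-(a * u t 0 ^ 2) - 2 * c * ∫ x, ux t x * ux t x ∂halfLine) (Ici 0) t := by
    intro t ht
    have h1 := (h.deriv_curve t ht).inner ℝ (h.deriv_curve t ht)
    have h2 := ((h.deriv_trace t ht).pow 2).const_mul (c / a)
    refine (h1.add h2).congr_deriv ?_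
    have h3 := (h.sobolev t ht).integral_mul_add (h.sobolev t ht)
    have h4 : ∫ x, u t x * ux t x ∂halfLine = ∫ x, ux t x * u t x ∂halfLine := by
      simp only [mul_comm]
    rw [real_inner_comm (F t) (F' t), h.inner_deriv ht (h.sobolev t ht) (h.eq_curve t ht), h.flux t ht]
    rw [h4] at h3
    have h5 : ∫ x, ux t x * u t x ∂halfLine = -(u t 0 * u t 0) / 2 := by linarith
    rw [h5]
    push_cast
    field_simp
    ring
  have hanti : AntitoneOn E (Ici 0) := by
    refine antitoneOn_of_deriv_nonpos (convex_Ici 0)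
      (fun t ht => (hder t ht).continuousWithinAt) ?_ ?_
    · rw [interior_Ici]
      intro t ht
      exact ((hder t (le_of_lt ht)).mono Ioi_subset_Ici_self).differentiableWithinAt
    · rw [interior_Ici]
      intro t ht
      rw [((hder t (le_of_lt ht)).hasDerivAt (Ici_mem_nhds ht)).deriv]
      have h1 : 0 ≤ ∫ x, ux t x * ux t x ∂halfLine :=
        integral_nonneg fun x => mul_self_nonneg _
      have h2 : 0 ≤ a * u t 0 ^ 2 := by positivity
      have h3 := mul_nonneg hc.le h1
      linarith
  refine ⟨max (√(E 0)) (√(a / c * E 0)), fun t ht => ?_⟩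
  have hle : E t ≤ E 0 := hanti self_mem_Ici ht ht
  have hEt : E t = ‖F t‖ ^ 2 + c / a * u t 0 ^ 2 := by
    simp only [hE, real_inner_self_eq_norm_sq]
  have h0 : 0 ≤ c / a * u t 0 ^ 2 := by positivity
  have h1 : 0 ≤ ‖F t‖ ^ 2 := by positivity
  constructor
  · exact le_max_of_le_left (Real.le_sqrt_of_sq_le (by linarith))
  · refine le_max_of_le_right (Real.le_sqrt_of_sq_le ?_)
    rw [sq_abs]
    calc u t 0 ^ 2 = a / c * (c / a * u t 0 ^ 2) := by field_simp
      _ ≤ a / c * E 0 := by gcongr; linarith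

theorem continuousOn_trace (h : SolutionCurve a c u ux uxx uB F F') :
    ContinuousOn (fun t => u t 0) (Ici 0) := fun t ht => (h.deriv_trace t ht).continuousWithinAt

/-- The flux relation eliminates ∂ₓu(t,0), leaving an ODE in the trace and `uB` alone. -/
theorem hasDerivAt_trace (h : SolutionCurve a c u ux uxx uB F F') (hc : c ≠ 0) {t : ℝ}
    (ht : 0 < t) : HasDerivAt (fun s => u s 0) (a / c * (uB t - a * u t 0)) t := by
  refine ((h.deriv_trace t ht.le).hasDerivAt (Ici_mem_nhds ht)).congr_deriv ?_
  rw [h.flux t ht.le]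
  field_simp
  ring

theorem aestronglyMeasurable_trace (h : SolutionCurve a c u ux uxx uB F F') :
    AEStronglyMeasurable (fun t => u t 0) halfLine :=
  (h.continuousOn_trace.mono Ioi_subset_Ici_self).aestronglyMeasurable measurableSet_Ioi

/-- Nothing is assumed on the regularity of `uB`; it is recovered from the trace and its derivative,
and a derivative is always measurable. -/
theorem aestronglyMeasurable_flux (h : SolutionCurve a c u ux uxx uB F F') (ha : a ≠ 0)
    (hc : c ≠ 0) : AEStronglyMeasurable uB halfLine := by
  have h1 : AEStronglyMeasurable (fun t => a * u t 0 + c / a * deriv (fun s => u s 0) t)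
      halfLine := (h.aestronglyMeasurable_trace.const_mul a).add
        ((measurable_deriv _).aestronglyMeasurable.const_mul _)
  refine h1.congr ?_
  filter_upwards [ae_restrict_mem measurableSet_Ioi] with t ht
  rw [(h.hasDerivAt_trace hc ht).deriv]
  field_simp
  ring

theorem integrable_trace (h : SolutionCurve a c u ux uxx uB F F') (ha : 0 < a) (hc : 0 < c)
    {q : ℝ} (hq : 0 < q) : Integrable (fun t => Real.exp (-q * t) * u t 0) halfLine := by
  obtain ⟨K, hK⟩ := h.exists_bound ha hc
  refine Integrable.mono' ((integrableOn_exp_mul_Ioi (a := -q) (by linarith) 0).mul_const K)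
    ((Continuous.aestronglyMeasurable (by fun_prop)).mul h.aestronglyMeasurable_trace) ?_
  filter_upwards [ae_restrict_mem measurableSet_Ioi] with t ht
  rw [norm_mul, Real.norm_eq_abs, Real.norm_eq_abs, abs_of_pos (Real.exp_pos _)]
  exact mul_le_mul_of_nonneg_left (hK t (le_of_lt ht)).2 (Real.exp_pos _).le

theorem tendsto_exp_neg_mul_mul_bounded {f : ℝ → ℝ} {q K : ℝ} (hq : 0 < q)
    (hf : ∀ t : ℝ, 0 ≤ t → |f t| ≤ K) :
    Tendsto (fun t => Real.exp (-q * t) * f t) atTop (𝓝 0) := by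
  have h1 : Tendsto (fun t : ℝ => Real.exp (-q * t) * K) atTop (𝓝 (0 * K)) := by
    refine Tendsto.mul_const K (Real.tendsto_exp_atBot.comp ?_)
    exact tendsto_id.const_mul_atTop_of_neg (by linarith)
  rw [zero_mul] at h1
  refine squeeze_zero_norm' ?_ h1
  filter_upwards [eventually_ge_atTop 0] with t ht
  rw [norm_mul, Real.norm_eq_abs, Real.norm_eq_abs, abs_of_pos (Real.exp_pos _)]
  exact mul_le_mul_of_nonneg_left (hf t ht) (Real.exp_pos _).le

/-- Laplace transform in time of a bounded solution of `f' = q f - k`. -/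
theorem integral_exp_neg_mul_eq {f k : ℝ → ℝ} {q K : ℝ} (hq : 0 < q)
    (hcont : ContinuousOn f (Ici 0)) (hf : ∀ t : ℝ, 0 ≤ t → |f t| ≤ K)
    (hder : ∀ t : ℝ, 0 < t → HasDerivAt f (q * f t - k t) t)
    (hint : Integrable (fun t => Real.exp (-q * t) * k t) halfLine) :
    ∫ t, Real.exp (-q * t) * k t ∂halfLine = f 0 := by
  -- The derivative of e^{-qt} f is -e^{-qt} k, and boundedness of f with q > 0 kills the value at
  -- infinity.
  have h := integral_Ioi_of_hasDerivAt_of_tendsto (a := 0)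
    (f := fun t => Real.exp (-q * t) * f t) (f' := fun t => -(Real.exp (-q * t) * k t)) ?_ ?_
    hint.neg (tendsto_exp_neg_mul_mul_bounded hq hf)
  · rw [integral_neg] at h
    simp at h
    simpa using h
  · exact (Continuous.continuousWithinAt (by fun_prop)).mul (hcont 0 self_mem_Ici)
  · intro t ht
    have h1 : HasDerivAt (fun t : ℝ => -q * t) (-q) t := by
      simpa using (hasDerivAt_id t).const_mul (-q)
    exact (h1.exp.mul (hder t ht)).congr_deriv (by ring)

/-- The inversion formula on the positive real axis. -/
theorem integral_exp_initial (h : SolutionCurve a c u ux uxx uB F F') (ha : 0 < a) (hc : 0 < c)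
    (h0 : u 0 0 = 0) {p : ℝ} (hp : 0 < p)
    (hint : Integrable (fun t => Real.exp (-(a * p + c * p ^ 2) * t) * uB t) halfLine) :
    ∫ x, Real.exp (-p * x) * u 0 x ∂halfLine =
      (1 + p * (a / (a ^ 2 / c + (a * p + c * p ^ 2)))) *
        ∫ t, Real.exp (-(a * p + c * p ^ 2) * t) * uB t ∂halfLine := by
  set q := a * p + c * p ^ 2 with hq
  have hq0 : 0 < q := by positivity
  obtain ⟨K, hK⟩ := h.exists_bound ha hc
  have hiT := h.integrable_trace ha hc hq0
  set A := ∫ t, Real.exp (-q * t) * uB t ∂halfLine with hA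
  set B := ∫ t, Real.exp (-q * t) * u t 0 ∂halfLine with hB
  -- The trace ODE is put in the form f' = q f - k by adding and subtracting q f; the initial value
  -- is 0 by `h0`.
  have htrace : (q + a ^ 2 / c) * B - a / c * A = 0 := by
    have h1 := integral_exp_neg_mul_eq (f := fun t => u t 0)
      (k := fun t => (q + a ^ 2 / c) * u t 0 - a / c * uB t) hq0 h.continuousOn_trace
      (fun t ht => (hK t ht).2)
      (fun t ht => (h.hasDerivAt_trace hc.ne' ht).congr_deriv (by field_simp; ring))
      (((hiT.const_mul (q + a ^ 2 / c)).sub (hint.const_mul (a / c))).congr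
        (ae_of_all _ fun t => by simp only [Pi.sub_apply]; ring))
    rw [h0] at h1
    rw [← h1, hA, hB, ← integral_const_mul, ← integral_const_mul,
      ← integral_sub (hiT.const_mul _) (hint.const_mul _)]
    congr 1; ext t; ring
  have hφ := hasSobolevDeriv_exp_neg_mul hp
  set Φ : L2 := hφ.memLp.toLp _ with hΦ
  have hΦe : (fun x : ℝ => Real.exp (-p * x)) =ᵐ[halfLine] Φ := hφ.memLp.coeFn_toLp.symm
  have hin : ∀ t : ℝ, 0 ≤ t →
      inner ℝ Φ (F t) = ∫ x, Real.exp (-p * x) * u t x ∂halfLine := fun t ht =>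
    inner_eq_integral hΦe (h.eq_curve t ht)
  have hder : ∀ t : ℝ, 0 ≤ t → HasDerivWithinAt (fun s => inner ℝ Φ (F s))
      (q * inner ℝ Φ (F t) - (uB t + c * p * u t 0)) (Ici 0) t := by
    intro t ht
    have h1 := (hasDerivWithinAt_const t (Ici 0) Φ).inner ℝ (h.deriv_curve t ht)
    refine h1.congr_deriv ?_
    rw [inner_zero_left, add_zero, h.inner_deriv ht hφ hΦe, hin t ht]
    have h2 := hφ.integral_mul_add (h.sobolev t ht)
    simp only [mul_assoc, integral_const_mul, mul_zero, Real.exp_zero] at h2 ⊢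
    rw [eq_neg_iff_add_eq_zero] at h2
    linear_combination c * p * h2
  have hspace : A + c * p * B = inner ℝ Φ (F 0) := by
    have h1 := integral_exp_neg_mul_eq (f := fun t => inner ℝ Φ (F t))
      (k := fun t => uB t + c * p * u t 0) (K := ‖Φ‖ * K) hq0
      (fun t ht => (hder t ht).continuousWithinAt)
      (fun t ht => (abs_real_inner_le_norm _ _).trans (by gcongr; exact (hK t ht).1))
      (fun t ht => (hder t ht.le).hasDerivAt (Ici_mem_nhds ht))
      ((hint.add (hiT.const_mul (c * p))).congr
        (ae_of_all _ fun t => by simp only [Pi.add_apply]; ring))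
    rw [← h1, hA, hB, ← integral_const_mul, ← integral_add hint (hiT.const_mul _)]
    congr 1; ext t; ring
  rw [← hin 0 le_rfl, ← hspace]
  have hne : a ^ 2 / c + q ≠ 0 := by positivity
  have hBA : B = a / c * A / (a ^ 2 / c + q) := by
    rw [eq_div_iff hne]; linarith
  rw [hBA]
  field_simp

end SolutionCurve

end Telomere

/-! ### The region 𝒫_N and analytic continuation. -/

namespace Telomere

theorem IsApproxSolution.exists_solutionCurve {b m₁ m₂ N : ℝ} {n₀ : ℝ → ℝ} {u : ℝ → ℝ → ℝ}
    {uB : ℝ → ℝ} (hu : IsApproxSolution b m₁ m₂ N n₀ u uB) :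
    (∃ ux uxx F F', SolutionCurve (b * m₁) (b * m₂ / (2 * N)) u ux uxx uB F F') ∧
      ∀ x : ℝ, 0 ≤ x → u 0 x = n₀ x := by
  obtain ⟨ux, uxx, ut, hsob, -, -, -, ⟨F, F', -, hF⟩, hpde, htr, hflux, hinit⟩ := hu
  refine ⟨⟨ux, uxx, F, F', ⟨fun t ht => (hsob t ht).1, fun t ht => (hsob t ht).2,
    fun t ht => (hF t ht).1, fun t ht => ?_, fun t ht => (hF t ht).2.2, htr, hflux⟩⟩, hinit⟩
  filter_upwards [hpde t ht, (hF t ht).2.1] with x hx hx'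
  rw [← hx', hx]

theorem IsDensityOnIcc.shorteningMoment_nonneg {g : ℝ → ℝ} {δ : ℝ} (hg : IsDensityOnIcc g δ)
    (hδ : 0 ≤ δ) (i : ℕ) : 0 ≤ shorteningMoment g δ i :=
  intervalIntegral.integral_nonneg hδ fun v hv =>
    mul_nonneg (pow_nonneg hv.1 i) (hg.nonneg v hv)

theorem continuous_qN (b m₁ m₂ N : ℝ) : Continuous (qN b m₁ m₂ N) := by
  unfold qN; fun_prop

theorem qN_ofReal (b m₁ m₂ N x : ℝ) :
    qN b m₁ m₂ N x = ((b * m₁ * x + b * m₂ / (2 * N) * x ^ 2 : ℝ) : ℂ) := by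
  simp [qN]

theorem isOpen_regionP (b m₁ m₂ N : ℝ) (n₀ uB : ℝ → ℝ) : IsOpen (regionP b m₁ m₂ N n₀ uB) :=
  (isOpen_lt continuous_const (continuous_coe_real_ereal.comp Complex.continuous_re)).inter
    (isOpen_lt continuous_const (continuous_coe_real_ereal.comp
      (Complex.continuous_re.comp (continuous_qN b m₁ m₂ N))))

/-- The second threshold in 𝒫_N says exactly that the denominator has positive real part. -/
theorem denominator_ne_zero {b m₁ m₂ N : ℝ} {n₀ uB : ℝ → ℝ} {z : ℂ}
    (hz : z ∈ regionP b m₁ m₂ N n₀ uB) :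
    ((b : ℂ) * m₁) ^ 2 * (2 * N / ((b : ℂ) * m₂)) + qN b m₁ m₂ N z ≠ 0 := by
  have h1 := EReal.coe_lt_coe_iff.1 ((le_max_right _ _).trans_lt hz.2)
  have h2 : ((b : ℂ) * m₁) ^ 2 * (2 * N / ((b : ℂ) * m₂))
      = (((b * m₁) ^ 2 * (2 * N / (b * m₂)) : ℝ) : ℂ) := by simp
  intro h
  have h3 := congrArg Complex.re h
  rw [Complex.add_re, h2, Complex.ofReal_re, Complex.zero_re] at h3
  linarith

/-- The inversion formula at the positive real points of the region. -/
theorem laplace_eq_of_pos {b m₁ m₂ N : ℝ} (ha : 0 < b * m₁) (hc : 0 < b * m₂ / (2 * N))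
    {n₀ uB : ℝ → ℝ} {u : ℝ → ℝ → ℝ} (hzero : n₀ 0 = 0)
    (hu : IsApproxSolution b m₁ m₂ N n₀ u uB) {x : ℝ} (hx : 0 < x)
    (hxP : (x : ℂ) ∈ regionP b m₁ m₂ N n₀ uB) :
    laplace n₀ x = (1 + x * ((b : ℂ) * m₁ /
        (((b : ℂ) * m₁) ^ 2 * (2 * N / ((b : ℂ) * m₂)) + qN b m₁ m₂ N x))) *
      laplace uB (qN b m₁ m₂ N x) := by
  obtain ⟨⟨ux, uxx, F, F', h⟩, hinit⟩ := hu.exists_solutionCurve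
  obtain ⟨r, hr, hrint⟩ := exists_integrable_of_abscissa_lt ((le_max_left _ _).trans_lt hxP.2)
  rw [qN_ofReal, Complex.ofReal_re] at hr
  have hmeas := h.aestronglyMeasurable_flux ha.ne' hc.ne'
  have hint : Integrable (fun t : ℝ =>
      Real.exp (-(b * m₁ * x + b * m₂ / (2 * N) * x ^ 2) * t) * uB t) halfLine := by
    have h1 := integrable_laplace hmeas
      (s := ((b * m₁ * x + b * m₂ / (2 * N) * x ^ 2 : ℝ) : ℂ)) (by rw [Complex.ofReal_re]; exact hr.le) hrint
    refine h1.re.congr (ae_of_all _ fun t => ?_)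
    simp only [← Complex.ofReal_neg, ← Complex.ofReal_mul, ← Complex.ofReal_exp]
    exact Complex.ofReal_re _
  have key := h.integral_exp_initial ha hc ((hinit 0 le_rfl).trans hzero) hx hint
  have hinit' : ∫ y in Ioi (0 : ℝ), Real.exp (-x * y) * n₀ y
      = ∫ y, Real.exp (-x * y) * u 0 y ∂halfLine :=
    setIntegral_congr_fun measurableSet_Ioi fun y hy => by
      simp only [hinit y (le_of_lt hy)]
  rw [qN_ofReal, laplace_ofReal, laplace_ofReal, hinit', key]
  have hden : (b * m₁) ^ 2 / (b * m₂ / (2 * N)) = (b * m₁) ^ 2 * (2 * N / (b * m₂)) := by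
    rw [div_div_eq_mul_div, mul_div_assoc]
  rw [hden]
  push_cast
  rfl

end Telomere

theorem mainTheorem2
    (b δ N : ℝ) (hb : 0 < b) (hδ : 0 < δ) (hN : 0 < N)
    (g : ℝ → ℝ) (hg : Telomere.IsDensityOnIcc g δ)
    (m₁ m₂ : ℝ) (hm₁ : m₁ = Telomere.shorteningMoment g δ 1)
    (hm₂ : m₂ = Telomere.shorteningMoment g δ 2)
    (n₀ n₀' n₀'' n₀''' : ℝ → ℝ) (hn₀ : Telomere.IsDensityOnIci n₀)
    (hn₀' : Telomere.HasSobolevDeriv n₀ n₀')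
    (hn₀'' : Telomere.HasSobolevDeriv n₀' n₀'')
    (hn₀''' : Telomere.HasSobolevDeriv n₀'' n₀''')
    (hzero : n₀ 0 = 0) (hzero'' : n₀'' 0 = 0)
    (C D lam lam' : ℝ) (hC : 0 < C) (hD : 0 < D) (hlam : 0 < lam)
    (hlam' : lam' ∈ Set.Ico 0 (2 * N * m₁ / m₂ - 2 * lam))
    (hbound''' : ∀ᵐ x ∂Telomere.halfLine, |n₀''' x| ≤ C * Real.exp (-lam * x))
    (hbound'' : ∀ x : ℝ, 0 ≤ x →
      |n₀'' x| ≤ D * Real.exp (-lam * x) * (1 - Real.exp (-lam' * x)))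
    (u : ℝ → ℝ → ℝ) (uB : ℝ → ℝ)
    (hu : Telomere.IsApproxSolution b m₁ m₂ N n₀ u uB)
    (p : ℂ) (hp : p ∈ Telomere.regionPMain b m₁ m₂ N n₀ uB) :
    Telomere.laplace n₀ p =
      (1 + p * ((b : ℂ) * m₁ /
          (((b : ℂ) * m₁) ^ 2 * (2 * N / ((b : ℂ) * m₂)) + Telomere.qN b m₁ m₂ N p))) *
        Telomere.laplace uB (Telomere.qN b m₁ m₂ N p) := by

  obtain ⟨x, hx, hpx⟩ := hp
  -- The interval containing `lam'` is nonempty and `lam` > 0. As division by 0 returns 0,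
  -- positivity of the ratio excludes both m₁ = 0 and m₂ = 0.
  have hratio : 0 < 2 * N * m₁ / m₂ := by linarith [hlam'.1, hlam'.2]
  have hm₁0 : 0 < m₁ := lt_of_le_of_ne (hm₁ ▸ hg.shorteningMoment_nonneg hδ.le 1) fun h => by
    simp [← h] at hratio
  have hm₂0 : 0 < m₂ := lt_of_le_of_ne (hm₂ ▸ hg.shorteningMoment_nonneg hδ.le 2) fun h => by
    simp [← h] at hratio
  have ha : 0 < b * m₁ := by positivity
  have hc : 0 < b * m₂ / (2 * N) := by positivity
  obtain ⟨⟨ux, uxx, F, F', h⟩, -⟩ := hu.exists_solutionCurve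
  set P := Telomere.regionP b m₁ m₂ N n₀ uB with hP
  have hPo : IsOpen P := Telomere.isOpen_regionP b m₁ m₂ N n₀ uB
  set V := connectedComponentIn P (x : ℂ) with hV
  have hVP : V ⊆ P := connectedComponentIn_subset _ _
  have hxP : (x : ℂ) ∈ P := connectedComponentIn_nonempty_iff.1 ⟨p, hpx⟩
  have hq : Differentiable ℂ (Telomere.qN b m₁ m₂ N) := by unfold Telomere.qN; fun_prop
  have hL : AnalyticOnNhd ℂ (Telomere.laplace n₀) V :=
    DifferentiableOn.analyticOnNhd (fun z hz =>
      (Telomere.differentiableAt_laplace hn₀.integrable.aestronglyMeasurable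
        (hVP hz).1).differentiableWithinAt) hPo.connectedComponentIn
  have hR : AnalyticOnNhd ℂ (fun z => (1 + z * ((b : ℂ) * m₁ /
      (((b : ℂ) * m₁) ^ 2 * (2 * N / ((b : ℂ) * m₂)) + Telomere.qN b m₁ m₂ N z))) *
      Telomere.laplace uB (Telomere.qN b m₁ m₂ N z)) V := by
    refine DifferentiableOn.analyticOnNhd (fun z hz => ?_) hPo.connectedComponentIn
    have h1 : DifferentiableAt ℂ (fun z => Telomere.laplace uB (Telomere.qN b m₁ m₂ N z)) z :=
      (Telomere.differentiableAt_laplace (h.aestronglyMeasurable_flux ha.ne' hc.ne')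
        ((le_max_left _ _).trans_lt (hVP hz).2)).comp z hq.differentiableAt
    have h2 := Telomere.denominator_ne_zero (hVP hz)
    exact (((differentiableAt_id.mul ((differentiableAt_const _).div
      (hq.differentiableAt.const_add _) h2)).const_add 1).mul h1).differentiableWithinAt
  -- 𝒫_N is open, so the real points near x lie in it; they accumulate at x, as the identity theorem
  -- requires.
  refine hL.eqOn_of_preconnected_of_frequently_eq hR isPreconnected_connectedComponentIn
    (mem_connectedComponentIn hxP) ?_ hpx
  have htend : Tendsto (fun y : ℝ => (y : ℂ)) (𝓝[≠] x) (𝓝[≠] (x : ℂ)) :=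
    Complex.continuous_ofReal.continuousWithinAt.tendsto_nhdsWithin
      fun y hy => by simpa using hy
  refine htend.frequently (Eventually.frequently ?_)
  have hev : ∀ᶠ y : ℝ in 𝓝 x, 0 < y ∧ (y : ℂ) ∈ P :=
    (eventually_gt_nhds hx).and
      (Complex.continuous_ofReal.continuousAt.eventually_mem (hPo.mem_nhds hxP))
  filter_upwards [hev.filter_mono nhdsWithin_le_nhds] with y hy
  exact Telomere.laplace_eq_of_pos ha hc hzero hu hy.1 hy.2
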